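/- **Conventions.** Let $\mathbb S$ be a commutative semiring. A ranked alphabet is a finite set $\Sigma$ in which each symbol $\sigma$ has a rank in $\mathbb N$. For a set $Z$ (disjoint from $\Sigma$), $T_\Sigma(Z)$ is the set of finite trees whose inner nodes and leaves are labeled by symbols $\sigma\in\Sigma$ with as many children as the rank of $\sigma$, and where leaves may also be labeled by elements of $Z$; $T_\Sigma = T_\Sigma(\emptyset)$. Positions are words in $\mathbb N^*$, $\mathrm{pos}(t)$ is the set of positions of $t$, $t|_w$ is the subtree of $t$ at position $w$, and $t[t']_w$ is obtained from $t$ by replacing that subtree by $t'$. A *weighted tree grammar with constraints* (WTGc) $G=(Q,\Sigma,F,P,\mathrm{wt})$ over $\mathbb S$ consists of a finite set $Q$ of nonterminals, final weights $F\colon Q\to\mathbb S$, a finite set $P$ of productions $p=(\ell,q,E,I)$ with $\ell\in T_\Sigma(Q)\setminus Q$, $q\in Q$ and finite sets $E,I\subseteq\mathbb N^*\times\mathbb N^*$ (equality and inequality constraints), and weights $\mathrm{wt}\colon P\to\mathbb S$. A tree $t\in T_\Sigma$ satisfies $(v,v')$ if $v,v'\in\mathrm{pos}(t)$ and $t|_v=t|_{v'}$.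 For $t\in T_\Sigma$, $\xi,\zeta\in T_\Sigma(Q)$, $p=(\ell,q,E,I)\in P$ and $w\in\mathrm{pos}(\xi)$ we write $\xi\Rightarrow^{p,w}_{G,t}\zeta$ if $\xi|_w=\ell$, $\zeta=\xi[q]_w$, and $t|_w$ satisfies every element of $E$ and no element of $I$. A complete left-most derivation of $G$ for $t$ to $q$ is a sequence $d=(p_1,w_1)\cdots(p_n,w_n)$ with $t\Rightarrow^{p_1,w_1}_{G,t}\xi_1\Rightarrow^{p_2,w_2}_{G,t}\cdots\Rightarrow^{p_n,w_n}_{G,t}\xi_n=q$ for some $\xi_1,\dots,\xi_n \in T_\Sigma(Q)$ and $w_1\prec\dots\prec w_n$, where $\prec$ is the strict lexicographic order on $\mathbb N^*$ in which prefixes are larger. Let $D^q_G(t)$ be the (finite) set of these derivations and $\mathrm{wt}_G(d)=\prod_{i}\mathrm{wt}(p_i)$. The weighted tree language generated by $G$, also written $G\colon T_\Sigma\to\mathbb S$, is $$G_t=\sum_{q\in Q}\ \sum_{d\in D_G^q(t)}F_q\cdot \mathrm{wt}_G(d).$$ The WTGc $G$ is a *weighted tree automaton* (WTA) if every production has the form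 $(\sigma(q_1,\dots,q_k),q,\emptyset,\emptyset)$ with $q_1,\dots,q_k\in Q$. It is *positive* if $I=\emptyset$ for every production, and *classic* if for every production $(\ell,q,E,I)$ and every $(v,v')\in E\cup I$ both $v$ and $v'$ are positions of $\ell$ labeled by nonterminals. A *sink nonterminal* is a $\bot\in Q$ with $F_\bot=0$ such that the productions with target $\bot$ are exactly the productions $(\sigma(\bot,\dots,\bot),\bot,\emptyset,\emptyset)$ for $\sigma\in\Sigma$, each with weight $1$. A classic WTGc is *eq-restricted* if it has a sink nonterminal $\bot$ such that for every production $(\ell,q,E,I)$ the following holds. Let $\equiv$ be the smallest equivalence relation containing $E$ on the set of nonterminal-labeled positions of $\ell$. Then for each such position $i$ there is $q'\in Q$ such that every position in the $\equiv$-class of $i$ is labeled by $q'$ or by $\bot$, and exactly one position in this class is labeled by $q'$. A *tree homomorphism* $h\colon T_\Sigma\to T_\Delta$ is given by trees $h_\sigma\in T_\Delta(\{x_1,\dots,x_k\})$ for each $\sigma\in\Sigma$ of rank $k$, and $h(\sigma(t_1,\dots,t_k))$ is obtained from $h_\sigma$ by replacing each $x_i$ by $h(t_i)$. It is *nonerasing*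 if no $h_\sigma$ is a single variable, and *nondeleting* if each of $x_1,\dots,x_k$ occurs in $h_\sigma$ for every $\sigma$ of rank $k$. For nondeleting and nonerasing $h$ each $h^{-1}(u)$ is finite, and for $A\colon T_\Sigma\to\mathbb S$ the weighted tree language $h(A)\colon T_\Delta\to\mathbb S$ is defined by $h(A)_u=\sum_{t\in h^{-1}(u)}A_t$. **Theorem.** Let $\mathbb S$ be a commutative semiring, $\Sigma$ and $\Delta$ ranked alphabets, $G=(Q,\Sigma,F,P,\mathrm{wt})$ a WTA over $\mathbb S$, and $h\colon T_\Sigma\to T_\Delta$ a nondeleting and nonerasing tree homomorphism. Then there exists an eq-restricted, positive, and classic WTGc $G'$ over $\mathbb S$ with input alphabet $\Delta$ such that $G'=h(G)$, i.e. $G'_u=\sum_{t\in h^{-1}(u)}G_t$ for every $u\in T_\Delta$. -/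

import Mathlib

universe u v w x y

namespace TreeGrammar

/-! ### Trees over a ranked alphabet

A ranked alphabet is a finite type `A` with a rank map `rk : A → ℕ`. -/

/-- The trees `T_Σ(Z)` over the ranked alphabet `(A, rk)` indexed by `Z`. -/
inductive RTree {A : Type u} (rk : A → ℕ) (Z : Type v) : Type (max u v)
  | var (z : Z) : RTree rk Z
  | node (a : A) (ts : Fin (rk a) → RTree rk Z) : RTree rk Z

/-- The trees `T_Σ = T_Σ(∅)`. -/
abbrev GTree {A : Type u} (rk : A → ℕ) : Type u := RTree rk Empty

namespace RTree

variable {A : Type u} {rk : A → ℕ} {Z : Type v} {Y : Type w}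

/-- The subtree `t|_w`, or `none` if `w` is not a position of `t`. Positions are words over `ℕ`;
the children of a symbol of rank `k` are numbered `0, …, k - 1`. -/
def subAt : RTree rk Z → List ℕ → Option (RTree rk Z)
  | t, [] => some t
  | var _, _ :: _ => none
  | node a ts, i :: w => if h : i < rk a then (ts ⟨i, h⟩).subAt w else none

/-- The set of positions of a tree. -/
def pos (t : RTree rk Z) : Set (List ℕ) := {w | ∃ s, t.subAt w = some s}

/-- The set `pos_Z(t)` of those positions of `t` that are labeled by elements of `Z`. -/
def varPos (t : RTree rk Z) : Set (List ℕ) := {w | ∃ z, t.subAt w = some (var z)}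

/-- The set of those elements of `Z` that occur in `t`. -/
def vars (t : RTree rk Z) : Set Z := {z | ∃ w, t.subAt w = some (var z)}

/-- The replacement `t[t']_w` of the subtree at position `w` by `t'`. -/
def replaceAt (t' : RTree rk Z) : RTree rk Z → List ℕ → RTree rk Z
  | _, [] => t'
  | var z, _ :: _ => var z
  | node a ts, i :: w =>
      node a (fun j => if (j : ℕ) = i then replaceAt t' (ts j) w else ts j)

/-- Simultaneous substitution `tθ`. -/
def subst (θ : Z → RTree rk Y) : RTree rk Z → RTree rk Y
  | var z => θ z
  | node a ts => node a (fun i => subst θ (ts i))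

/-- The inclusion of `T_Σ` into `T_Σ(Z)`. -/
def ofGround (t : GTree rk) : RTree rk Z := t.subst Empty.elim

end RTree

/-! ### Tree homomorphisms -/

/-- A map `h'` that assigns to each symbol of rank `k` a tree in `T_Δ(X_k)`, where the variables
`X_k` are represented by `Fin k`. -/
def TreeHom {A : Type u} {B : Type v} (rkA : A → ℕ) (rkB : B → ℕ) : Type (max u v) :=
  (a : A) → RTree rkB (Fin (rkA a))

namespace TreeHom

variable {A : Type u} {B : Type v} {rkA : A → ℕ} {rkB : B → ℕ}

/-- The tree homomorphism induced by `h'`. -/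
def apply (h : TreeHom rkA rkB) : GTree rkA → GTree rkB
  | .node a ts => (h a).subst (fun i => h.apply (ts i))

/-- No right-hand side is a single variable. -/
def Nonerasing (h : TreeHom rkA rkB) : Prop := ∀ a i, h a ≠ RTree.var i

/-- Every variable occurs in the right-hand side. -/
def Nondeleting (h : TreeHom rkA rkB) : Prop := ∀ a, (h a).vars = Set.univ

/-- The image `h(L)` of a weighted tree language: `h(L)_u` is the sum of `L_t` over all `t` with
`h(t) = u`. For nondeleting and nonerasing `h` this sum is finite, see
`TreeHom.finite_preimage`. -/
noncomputable def image {S : Type w} [CommSemiring S] (h : TreeHom rkA rkB) (L : GTree rkA → S) :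
    GTree rkB → S :=
  fun u => ∑ᶠ t ∈ {t | h.apply t = u}, L t

end TreeHom

/-! ### Weighted tree grammars with constraints -/

/-- A constraint is a pair of positions. -/
abbrev Constraint : Type := List ℕ × List ℕ

/-- The tree `t` satisfies `(v, v')` if both are positions of `t` and the subtrees there
coincide. -/
def Satisfies {A : Type u} {rk : A → ℕ} (t : GTree rk) (c : Constraint) : Prop :=
  ∃ s, t.subAt c.1 = some s ∧ t.subAt c.2 = some s

/-- A production `ℓ → q` with finite sets of equality constraints and of inequality constraints,
where `ℓ ∈ T_Σ(Q) \ Q`. -/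
structure Production {A : Type u} (rk : A → ℕ) (Q : Type v) where
  lhs : RTree rk Q
  target : Q
  eqs : Finset Constraint
  neqs : Finset Constraint
  lhs_ne : ∀ q, lhs ≠ RTree.var q

namespace Production

variable {A : Type u} {rk : A → ℕ} {Q : Type v}

/-- The left-hand side is `σ(q₁, …, q_k)` with nonterminals `q₁, …, q_k`. -/
def Normalized (p : Production rk Q) : Prop :=
  ∃ (a : A) (qs : Fin (rk a) → Q), p.lhs = RTree.node a (fun i => RTree.var (qs i))

/-- No inequality constraints. -/
def Positive (p : Production rk Q) : Prop := p.neqs = ∅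

/-- No constraints at all. -/
def Unconstrained (p : Production rk Q) : Prop := p.eqs = ∅ ∧ p.neqs = ∅

/-- All constraints refer to nonterminal-labeled positions of the left-hand side. -/
def Classic (p : Production rk Q) : Prop :=
  ∀ c : Constraint, c ∈ p.eqs ∨ c ∈ p.neqs → c.1 ∈ p.lhs.varPos ∧ c.2 ∈ p.lhs.varPos

/-- The smallest equivalence relation on the nonterminal-labeled positions of the left-hand side
that contains the equality constraints (between such positions). -/
def Linked (p : Production rk Q) : p.lhs.varPos → p.lhs.varPos → Prop :=
  Relation.EqvGen (fun i j => ((i : List ℕ), (j : List ℕ)) ∈ p.eqs)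

/-- The unconstrained production `σ(q, …, q) → q`. -/
def loop (q : Q) (a : A) : Production rk Q where
  lhs := RTree.node a (fun _ => RTree.var q)
  target := q
  eqs := ∅
  neqs := ∅
  lhs_ne := fun _ h => by cases h

end Production

/-- A weighted tree grammar with constraints over the semiring `S`, the ranked alphabet `(A, rk)`
and the (finite) set `Q` of nonterminals. Only the values of `wt` on `prods` are ever used. -/
structure WTGc (S : Type w) {A : Type u} (rk : A → ℕ) (Q : Type v) where
  final : Q → S
  prods : Finset (Production rk Q)
  wt : Production rk Q → S

/-- The order `≺` on positions: the strict lexicographic order in which prefixes are larger. -/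
def Precedes : List ℕ → List ℕ → Prop
  | [], _ => False
  | _ :: _, [] => True
  | i :: v, j :: w => i < j ∨ (i = j ∧ Precedes v w)

namespace WTGc

variable {S : Type w} {A : Type u} {rk : A → ℕ} {Q : Type v}

/-- All productions are positive. -/
def Positive (G : WTGc S rk Q) : Prop := ∀ p ∈ G.prods, p.Positive

/-- All productions are classic. -/
def Classic (G : WTGc S rk Q) : Prop := ∀ p ∈ G.prods, p.Classic

/-- A weighted tree automaton: all productions are normalized and unconstrained. -/
def IsWTA (G : WTGc S rk Q) : Prop := ∀ p ∈ G.prods, p.Normalized ∧ p.Unconstrained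

/-- The derivation step from `ξ` to `ζ` for the input tree `t` that uses production `p` at
position `w`. -/
def Step (G : WTGc S rk Q) (t : GTree rk) (p : Production rk Q) (w : List ℕ)
    (ξ ζ : RTree rk Q) : Prop :=
  p ∈ G.prods ∧ ξ.subAt w = some p.lhs ∧ ζ = RTree.replaceAt (RTree.var p.target) ξ w ∧
    ∃ s, t.subAt w = some s ∧ (∀ c ∈ p.eqs, Satisfies s c) ∧ (∀ c ∈ p.neqs, ¬ Satisfies s c)

/-- `G.Derives t d ξ ζ`: the sequence `d` of pairs of productions and positions leads from the
sentential form `ξ` to the sentential form `ζ`, for the input tree `t`. -/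
def Derives (G : WTGc S rk Q) (t : GTree rk) :
    List (Production rk Q × List ℕ) → RTree rk Q → RTree rk Q → Prop
  | [], ξ, ζ => ξ = ζ
  | (p, w) :: d, ξ, ζ => ∃ η, G.Step t p w ξ η ∧ G.Derives t d η ζ

/-- The set `D_G^q(t)` of complete left-most derivations of `G` for `t` to `q`. -/
def derivations (G : WTGc S rk Q) (q : Q) (t : GTree rk) :
    Set (List (Production rk Q × List ℕ)) :=
  {d | G.Derives t d t.ofGround (RTree.var q) ∧ (d.map Prod.snd).Pairwise Precedes}

/-- The weight of a derivation. -/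
def derivWt [CommSemiring S] (G : WTGc S rk Q) (d : List (Production rk Q × List ℕ)) : S :=
  (d.map (fun s => G.wt s.1)).prod

/-- The weighted tree language generated by `G`. The inner sum is finite, see
`WTGc.finite_derivations`. -/
noncomputable def language [CommSemiring S] [Fintype Q] (G : WTGc S rk Q) : GTree rk → S :=
  fun t => ∑ q, ∑ᶠ d ∈ G.derivations q t, G.final q * G.derivWt d

/-- `bot` is a sink nonterminal: its final weight is `0`, and the productions with target `bot`
are exactly the productions `σ(bot, …, bot) → bot`, with weight `1`. -/
def IsSink [CommSemiring S] (G : WTGc S rk Q) (bot : Q) : Prop :=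
  G.final bot = 0 ∧
    {p | p ∈ G.prods ∧ p.target = bot} = Set.range (Production.loop (rk := rk) bot) ∧
    ∀ a, G.wt (Production.loop bot a) = 1

/-- Eq-restrictedness. The occurrences of nonterminals in a left-hand side
`ℓ = c[q₁, …, q_k]` are indexed by their positions in `ℓ` instead of by `1, …, k`. -/
def EqRestricted [CommSemiring S] (G : WTGc S rk Q) : Prop :=
  ∃ bot, G.IsSink bot ∧ ∀ p ∈ G.prods, ∀ i : p.lhs.varPos, ∃ q' : Q,
    (∀ j : p.lhs.varPos, p.Linked i j →
      p.lhs.subAt j = some (RTree.var q') ∨ p.lhs.subAt j = some (RTree.var bot)) ∧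
    ∃! j : p.lhs.varPos, p.Linked i j ∧ p.lhs.subAt j = some (RTree.var q')

end WTGc

/-! ### The sums in the definitions are finite -/

namespace RTree

variable {A : Type u} {rk : A → ℕ} {Z : Type v} {Y : Type w}

theorem finite_pos (t : RTree rk Z) : t.pos.Finite := by
  induction t with
  | var z =>
    refine (Set.finite_singleton []).subset ?_
    rintro (_ | ⟨i, w⟩) ⟨s, hs⟩
    · rfl
    · simp [subAt] at hs
  | node a ts ih =>
    refine ((Set.finite_singleton ([] : List ℕ)).union
      (Set.finite_iUnion (fun i => (ih i).image (List.cons (i : ℕ))))).subset ?_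
    rintro (_ | ⟨i, w⟩) ⟨s, hs⟩
    · exact Or.inl rfl
    · rw [subAt] at hs
      split_ifs at hs with hi
      exact Or.inr (Set.mem_iUnion.2 ⟨⟨i, hi⟩, w, ⟨s, hs⟩, rfl⟩)

/-- The number of symbols on a longest branch. -/
def depth : RTree rk Z → ℕ
  | var _ => 0
  | node _ ts => (Finset.univ.sup fun i => (ts i).depth) + 1

theorem finite_depth_le [Finite A] (n : ℕ) : {t : GTree rk | t.depth ≤ n}.Finite := by
  induction n with
  | zero =>
    refine Set.finite_empty.subset ?_
    rintro (z | ⟨a, ts⟩) ht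
    · exact z.elim
    · simp [depth] at ht
  | succ n ih =>
    refine (Set.finite_iUnion (fun a : A =>
      (Set.Finite.pi (fun _ : Fin (rk a) => ih)).image (node a))).subset ?_
    rintro (z | ⟨a, ts⟩) ht
    · exact z.elim
    · refine Set.mem_iUnion.2 ⟨a, ts, fun i _ => ?_, rfl⟩
      have h1 : (Finset.univ.sup fun i => (ts i).depth) ≤ n := by
        simpa [depth] using ht
      exact (Finset.le_sup (f := fun i => (ts i).depth) (Finset.mem_univ i)).trans h1

theorem depth_le_subst (θ : Z → RTree rk Y) (z : Z) (w : List ℕ) :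
    ∀ t : RTree rk Z, t.subAt w = some (var z) → (θ z).depth + w.length ≤ (t.subst θ).depth := by
  induction w with
  | nil =>
    intro t ht
    simp only [subAt, Option.some.injEq] at ht
    subst ht
    simp [subst]
  | cons i w ih =>
    rintro (y | ⟨a, ts⟩) ht
    · simp [subAt] at ht
    · rw [subAt] at ht
      split_ifs at ht with hi
      have h1 := ih _ ht
      have h2 := Finset.le_sup (f := fun i => ((ts i).subst θ).depth)
        (Finset.mem_univ (⟨i, hi⟩ : Fin (rk a)))
      simp only [subst, depth, List.length_cons]
      omega

end RTree

theorem TreeHom.finite_preimage {A : Type u} {B : Type v} {rkA : A → ℕ} {rkB : B → ℕ} [Finite A]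
    (h : TreeHom rkA rkB) (hd : h.Nondeleting) (he : h.Nonerasing) (t' : GTree rkB) :
    {t | h.apply t = t'}.Finite := by
  have key : ∀ t : GTree rkA, t.depth ≤ (h.apply t).depth := by
    intro t
    induction t with
    | var z => exact z.elim
    | node a ts ih =>
      have hnode : ∃ b us, h a = RTree.node b us := by
        cases hc : h a with
        | var i => exact absurd hc (he a i)
        | node b us => exact ⟨b, us, rfl⟩
      have h1 : ∀ i, (ts i).depth + 1 ≤ (h.apply (RTree.node a ts)).depth := by
        intro i
        obtain ⟨w, hw⟩ : i ∈ (h a).vars := by rw [hd a]; trivial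
        have h2 := RTree.depth_le_subst (fun i => h.apply (ts i)) i w (h a) hw
        have h3 : w ≠ [] := by
          rintro rfl
          simp only [RTree.subAt, Option.some.injEq] at hw
          exact he a i hw
        have h4 := List.length_pos_iff.2 h3
        have h5 := ih i
        simp only [TreeHom.apply]
        omega
      have h0 : 1 ≤ (h.apply (RTree.node a ts)).depth := by
        obtain ⟨b, us, hb⟩ := hnode
        simp [TreeHom.apply, hb, RTree.subst, RTree.depth]
      have h6 : (Finset.univ.sup fun i => (ts i).depth) ≤
          (h.apply (RTree.node a ts)).depth - 1 :=
        Finset.sup_le fun i _ => by have := h1 i; omega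
      simp only [RTree.depth]
      omega
  refine (RTree.finite_depth_le t'.depth).subset ?_
  rintro t rfl
  exact key t

theorem Precedes.irrefl : ∀ v : List ℕ, ¬ Precedes v v
  | [], h => h
  | i :: v, h => by
    rcases h with h | ⟨-, h⟩
    · exact lt_irrefl i h
    · exact Precedes.irrefl v h

namespace WTGc

variable {S : Type w} {A : Type u} {rk : A → ℕ} {Q : Type v}

theorem Derives.mem {G : WTGc S rk Q} {t : GTree rk} :
    ∀ {d : List (Production rk Q × List ℕ)} {ξ ζ : RTree rk Q}, G.Derives t d ξ ζ →
      ∀ s ∈ d, s.1 ∈ G.prods ∧ s.2 ∈ t.pos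
  | [], _, _, _, s, hs => by simp at hs
  | (p, w) :: d, _, _, h, s, hs => by
    obtain ⟨η, ⟨hp, -, -, s', hs', -⟩, h2⟩ := h
    rcases List.mem_cons.1 hs with rfl | hs
    · exact ⟨hp, s', hs'⟩
    · exact Derives.mem h2 s hs

theorem finite_derivations (G : WTGc S rk Q) (q : Q) (t : GTree rk) :
    (G.derivations q t).Finite := by
  classical
  let T : Finset (Production rk Q × List ℕ) := G.prods ×ˢ t.finite_pos.toFinset
  have hT : {l : List (Production rk Q × List ℕ) | l.Nodup ∧ ∀ s ∈ l, s ∈ T}.Finite := by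
    refine ((List.finite_length_le T T.card).image (List.map Subtype.val)).subset ?_
    rintro l ⟨hl, hm⟩
    refine ⟨l.attach.map (fun s => ⟨s.1, hm s.1 s.2⟩), ?_, ?_⟩
    · have h1 : l.toFinset ⊆ T := fun s hs => hm s (List.mem_toFinset.1 hs)
      have h2 := Finset.card_le_card h1
      rw [List.toFinset_card_of_nodup hl] at h2
      simpa using h2
    · rw [List.map_map]
      exact List.attach_map_subtype_val l
  refine hT.subset ?_
  rintro d ⟨hd, hw⟩
  refine ⟨?_, fun s hs => ?_⟩
  · rw [List.pairwise_map] at hw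
    refine hw.imp ?_
    rintro a b hab rfl
    exact Precedes.irrefl _ hab
  · have := hd.mem s hs
    simp only [T, Finset.mem_product, Set.Finite.mem_toFinset]
    exact this

end WTGc

end TreeGrammar

/-!
The image of a weighted tree automaton `G` under `h` is generated by the following grammar, whose
nonterminals are those of `G` and a sink. In each `h_σ` one occurrence of every variable `x_i` is
chosen, which is possible because `h` is nondeleting. A production `σ(q₁, …, q_k) → q` is replaced
by `ℓ → q`, where `ℓ` arises from `h_σ` by writing `q_i` at the chosen occurrence of `x_i` and the
sink at all its other occurrences, and all occurrences of the same variable are linked by equality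
constraints. As `h` is nonerasing, `ℓ` is not a single nonterminal. If several productions of `G`
have the same image, their weights are added.

The languages are compared by evaluating grammars bottom-up. Let `weight t ξ` be the total weight of
all left-most derivations from `t` to the sentential form `ξ`. The last step of a derivation to a
nonterminal happens at the root, so `weight t q` is a sum over productions with target `q`
(`WTGc.weight_var`), and a derivation to a tree that is not a single nonterminal splits into
derivations in the children, so its weight is a product (`WTGc.weight_node`). This determines all
weights. The sink has weight `1` on every tree (`weight_imageGrammar_none`), and if a tree satisfies
the constraints of `ℓ → q` and matches `ℓ`, then it equals `h_σ[θ]` for a substitution `θ`, which is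
unique as `h` is nondeleting; the weight of `ℓ` is then the product of the weights of the `q_i` on
`θ i` (`WTGc.weight_relabel`). On the other side, the preimages of `h_σ[θ]` with root symbol `σ` are
the trees `σ(t₁, …, t_k)` with `h(t_i) = θ i` (`finsum_weight_preimage_subst`). Hence both sides
satisfy the same recursion, and they agree by induction on the depth of the output tree
(`weight_imageGrammar_some`).
-/

namespace TreeGrammar

/-! ### Evaluating a grammar bottom-up -/

theorem Precedes.asymm : ∀ {v w : List ℕ}, Precedes v w → ¬ Precedes w v
  | [], _, h, _ => h
  | _ :: _, [], _, h' => h'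
  | i :: v, j :: w, h, h' => by
    rcases h with h | ⟨rfl, h⟩ <;> rcases h' with h' | ⟨h1, h'⟩
    · omega
    · omega
    · omega
    · exact Precedes.asymm h h'

namespace WTGc

variable {S : Type w} {A : Type u} {rk : A → ℕ} {Q : Type v}

/-- The left-most derivations for `t` that start in `t` and end in an arbitrary sentential
form `ξ`. -/
def formDerivations (G : WTGc S rk Q) (t : GTree rk) (ξ : RTree rk Q) :
    Set (List (Production rk Q × List ℕ)) :=
  {d | G.Derives t d t.ofGround ξ ∧ (d.map Prod.snd).Pairwise Precedes}

/-- The total weight of the left-most derivations from `t` to the sentential form `ξ`. -/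
noncomputable def weight [CommSemiring S] (G : WTGc S rk Q) (t : GTree rk) (ξ : RTree rk Q) : S :=
  ∑ᶠ d ∈ G.formDerivations t ξ, G.derivWt d

theorem nodup_of_pairwise_precedes {d : List (Production rk Q × List ℕ)}
    (hd : (d.map Prod.snd).Pairwise Precedes) : d.Nodup := by
  rw [List.pairwise_map] at hd
  refine hd.imp ?_
  rintro a b hab rfl
  exact Precedes.irrefl _ hab

theorem finite_formDerivations (G : WTGc S rk Q) (t : GTree rk) (ξ : RTree rk Q) :
    (G.formDerivations t ξ).Finite := by
  classical
  let T : Finset (Production rk Q × List ℕ) := G.prods ×ˢ t.finite_pos.toFinset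
  refine ((List.finite_length_le T T.card).image (List.map Subtype.val)).subset ?_
  rintro d ⟨hd, hw⟩
  have hm : ∀ s ∈ d, s ∈ T := fun s hs => by
    simpa only [T, Finset.mem_product, Set.Finite.mem_toFinset] using hd.mem s hs
  refine ⟨d.attach.map (fun s => ⟨s.1, hm s.1 s.2⟩), ?_, ?_⟩
  · have h2 := Finset.card_le_card (show d.toFinset ⊆ T from
      fun s hs => hm s (List.mem_toFinset.1 hs))
    rw [List.toFinset_card_of_nodup (nodup_of_pairwise_precedes hw)] at h2
    simpa using h2
  · rw [List.map_map]
    exact List.attach_map_subtype_val d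

/-- Two left-most derivations with the same steps are equal. -/
theorem eq_of_pairwise_precedes {d d' : List (Production rk Q × List ℕ)}
    (hd : (d.map Prod.snd).Pairwise Precedes) (hd' : (d'.map Prod.snd).Pairwise Precedes)
    (h : ∀ s, s ∈ d ↔ s ∈ d') : d = d' := by
  have hp : d.Perm d' := (List.perm_ext_iff_of_nodup (nodup_of_pairwise_precedes hd)
    (nodup_of_pairwise_precedes hd')).2 h
  rw [List.pairwise_map] at hd hd'
  exact hp.eq_of_pairwise (fun a b _ _ h1 h2 => absurd h2 h1.asymm) hd hd'

/-! ### The last step of a derivation -/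

theorem Derives.of_var {G : WTGc S rk Q} {t : GTree rk}
    {d : List (Production rk Q × List ℕ)} {q : Q} {ζ : RTree rk Q}
    (h : G.Derives t d (.var q) ζ) : d = [] ∧ ζ = .var q := by
  rcases d with _ | ⟨⟨p, w⟩, d⟩
  · exact ⟨rfl, h.symm⟩
  · obtain ⟨η, ⟨-, h1, -⟩, -⟩ := h
    rcases w with _ | ⟨i, w⟩
    · simp only [RTree.subAt, Option.some.injEq] at h1
      exact absurd h1.symm (p.lhs_ne q)
    · simp [RTree.subAt] at h1

/-- A step at the root leaves a single nonterminal, to which no production applies. -/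
theorem Derives.ne_nil {G : WTGc S rk Q} {t : GTree rk} {a : A} {ζs : Fin (rk a) → RTree rk Q} :
    ∀ {d : List (Production rk Q × List ℕ)} {ξ : RTree rk Q},
      G.Derives t d ξ (.node a ζs) → ∀ s ∈ d, s.2 ≠ []
  | [], _, _, s, hs => by simp at hs
  | (p, w) :: d, ξ, h, s, hs => by
    obtain ⟨η, ⟨-, -, h3, -⟩, h2⟩ := h
    rcases List.mem_cons.1 hs with rfl | hs
    · rintro rfl
      subst h3
      cases ξ <;> exact absurd h2.of_var.2 (by simp)
    · exact Derives.ne_nil h2 s hs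

theorem derives_append {G : WTGc S rk Q} {t : GTree rk} {ζ : RTree rk Q} :
    ∀ {d d' : List (Production rk Q × List ℕ)} {ξ : RTree rk Q},
      G.Derives t (d ++ d') ξ ζ ↔ ∃ η, G.Derives t d ξ η ∧ G.Derives t d' η ζ
  | [], d', ξ => by simp [Derives]
  | (p, w) :: d, d', ξ => by
    simp only [List.cons_append, Derives, derives_append]
    constructor
    · rintro ⟨η, h1, η', h2, h3⟩
      exact ⟨η', ⟨η, h1, h2⟩, h3⟩
    · rintro ⟨η', ⟨η, h1, h2⟩, h3⟩
      exact ⟨η, h1, η', h2, h3⟩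

/-- The tree `t` satisfies all constraints of `p`. -/
def _root_.TreeGrammar.Production.Admits (p : Production rk Q) (t : GTree rk) : Prop :=
  (∀ c ∈ p.eqs, Satisfies t c) ∧ ∀ c ∈ p.neqs, ¬ Satisfies t c

theorem exists_node_lhs (p : Production rk Q) : ∃ a ts, p.lhs = .node a ts := by
  cases h : p.lhs with
  | var q => exact absurd h (p.lhs_ne q)
  | node a ts => exact ⟨a, ts, rfl⟩

theorem formDerivations_var (G : WTGc S rk Q) (t : GTree rk) (q : Q) :
    G.formDerivations t (.var q) =
      ⋃ p ∈ {p | p ∈ G.prods ∧ p.target = q ∧ p.Admits t},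
        (fun d => d ++ [(p, [])]) '' G.formDerivations t p.lhs := by
  ext d
  simp only [Set.mem_iUnion, Set.mem_image, Set.mem_ofPred_eq, exists_prop]
  constructor
  · rintro ⟨h1, h2⟩
    rcases List.eq_nil_or_concat d with rfl | ⟨d, ⟨p, w⟩, rfl⟩
    · cases t with
      | var z => exact z.elim
      | node a ts => simp [Derives, RTree.ofGround, RTree.subst] at h1
    · rw [List.concat_eq_append] at h1 h2 ⊢
      obtain ⟨η, h3, η', ⟨h4, h5, h6, s, h7, h8⟩, h9⟩ := derives_append.1 h1
      simp only [Derives] at h9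
      subst h9
      rcases w with _ | ⟨i, w⟩
      · simp only [RTree.subAt, Option.some.injEq] at h5 h7
        subst h5 h7
        simp only [RTree.replaceAt, RTree.var.injEq] at h6
        refine ⟨p, ⟨h4, h6.symm, h8⟩, d, ⟨h3, ?_⟩, rfl⟩
        rw [List.map_append, List.pairwise_append] at h2
        exact h2.1
      · cases η with
        | var z => simp [RTree.subAt] at h5
        | node a ts => simp [RTree.replaceAt] at h6
  · rintro ⟨p, ⟨h1, h2, h3⟩, d, ⟨h4, h5⟩, rfl⟩
    refine ⟨derives_append.2 ⟨p.lhs, h4, _,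
      ⟨h1, by simp [RTree.subAt], ?_, t, by simp [RTree.subAt], h3⟩, rfl⟩, ?_⟩
    · simp [RTree.replaceAt, h2]
    · rw [List.map_append, List.pairwise_append]
      refine ⟨h5, by simp, ?_⟩
      obtain ⟨a, ts, ha⟩ := exists_node_lhs p
      rw [ha] at h4
      simp only [List.mem_map, List.map_cons, List.map_nil, List.mem_singleton]
      rintro _ ⟨s, hs, rfl⟩ _ rfl
      have := h4.ne_nil s hs
      revert this
      cases s.2 <;> simp [Precedes]

/-- The last step of a derivation to a nonterminal takes place at the root. -/
theorem weight_var [CommSemiring S] (G : WTGc S rk Q) (t : GTree rk) (q : Q) :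
    G.weight t (.var q) =
      ∑ᶠ p ∈ {p | p ∈ G.prods ∧ p.target = q ∧ p.Admits t}, G.wt p * G.weight t p.lhs := by
  unfold weight
  rw [formDerivations_var, finsum_mem_biUnion]
  · refine finsum_mem_congr rfl fun p _ => ?_
    rw [finsum_mem_image (fun d _ d' _ h => List.append_cancel_right h),
      mul_finsum_mem' _ _ (G.finite_formDerivations t p.lhs)]
    refine finsum_mem_congr rfl fun d _ => ?_
    simp [derivWt, mul_comm]
  · intro p _ p' _ hpp'
    refine Set.disjoint_left.2 ?_
    rintro _ ⟨d, -, rfl⟩ ⟨d', -, h⟩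
    have := (List.append_inj' h rfl).2
    simp only [List.cons.injEq, Prod.mk.injEq, and_true] at this
    exact hpp' this.symm
  · exact G.prods.finite_toSet.subset fun p hp => hp.1
  · exact fun p _ => (G.finite_formDerivations t p.lhs).image _

/-! ### Splitting a derivation along the children of the root -/

/-- The steps of `d` that take place in the `i`-th child of the root, with positions relative to
that child. -/
def childSteps (i : ℕ) (d : List (Production rk Q × List ℕ)) : List (Production rk Q × List ℕ) :=
  d.filterMap fun s => match s with
    | (_, []) => none
    | (p, j :: w) => if j = i then some (p, w) else none

@[simp] theorem childSteps_nil (i : ℕ) :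
    childSteps i ([] : List (Production rk Q × List ℕ)) = [] := rfl

theorem childSteps_cons (i j : ℕ) (p : Production rk Q) (w : List ℕ)
    (d : List (Production rk Q × List ℕ)) :
    childSteps i ((p, j :: w) :: d) =
      if j = i then (p, w) :: childSteps i d else childSteps i d := by
  unfold childSteps
  split_ifs with h <;> simp [h]

theorem mem_childSteps {i : ℕ} {d : List (Production rk Q × List ℕ)} {p : Production rk Q}
    {w : List ℕ} : (p, w) ∈ childSteps i d ↔ (p, i :: w) ∈ d := by
  simp only [childSteps, List.mem_filterMap]
  constructor
  · rintro ⟨⟨p', _ | ⟨j, v⟩⟩, h1, h2⟩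
    · simp at h2
    · simp only at h2
      split_ifs at h2 with hj
      · simp only [Option.some.injEq, Prod.mk.injEq] at h2
        obtain ⟨rfl, rfl⟩ := h2
        rwa [← hj]
  · intro h
    exact ⟨_, h, by simp⟩

theorem pairwise_childSteps {i : ℕ} {d : List (Production rk Q × List ℕ)}
    (hd : (d.map Prod.snd).Pairwise Precedes) :
    ((childSteps i d).map Prod.snd).Pairwise Precedes := by
  rw [List.pairwise_map] at hd ⊢
  refine hd.filterMap _ ?_
  rintro ⟨p, _ | ⟨j, v⟩⟩ ⟨p', _ | ⟨j', v'⟩⟩ h b hb b' hb'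
  · simp at hb
  · simp at hb
  · simp at hb'
  · simp only [Option.ite_none_right_eq_some, Option.some.injEq] at hb hb'
    obtain ⟨rfl, rfl⟩ := hb
    obtain ⟨rfl, rfl⟩ := hb'
    rcases h with h | h
    · exact absurd h (lt_irrefl _)
    · exact h.2

/-- Derivations below the root are derivations in the individual children. -/
theorem derives_node_iff {G : WTGc S rk Q} {a : A} {ts : Fin (rk a) → GTree rk}
    {ζs : Fin (rk a) → RTree rk Q} :
    ∀ {d : List (Production rk Q × List ℕ)} {ξs : Fin (rk a) → RTree rk Q},
      (∀ s ∈ d, ∃ (i : Fin (rk a)) (w : List ℕ), s.2 = (i : ℕ) :: w) →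
      (G.Derives (.node a ts) d (.node a ξs) (.node a ζs) ↔
        ∀ i : Fin (rk a), G.Derives (ts i) (childSteps i d) (ξs i) (ζs i))
  | [], ξs, _ => by simp [Derives, funext_iff]
  | (p, w) :: d, ξs, hd => by
    obtain ⟨j, w, rfl⟩ : ∃ (j : Fin (rk a)) (v : List ℕ), w = (j : ℕ) :: v :=
      hd _ List.mem_cons_self
    have ih := fun ξs => derives_node_iff (G := G) (ts := ts) (ζs := ζs) (ξs := ξs)
      (fun s hs => hd s (List.mem_cons_of_mem _ hs))
    simp only [Derives, Step, RTree.subAt, j.2, dite_true, RTree.replaceAt]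
    constructor
    · rintro ⟨η, ⟨h1, h2, rfl, h4⟩, h5⟩ i
      have h6 := (ih _).1 h5 i
      rw [childSteps_cons]
      by_cases hij : j = i
      · subst hij
        simp only [if_true] at h6 ⊢
        exact ⟨_, ⟨h1, h2, rfl, h4⟩, h6⟩
      · have hij' : (j : ℕ) ≠ i := fun h => hij (Fin.ext h)
        simpa [hij', hij'.symm] using h6
    · intro h
      have hj := h j
      rw [childSteps_cons, if_pos rfl] at hj
      obtain ⟨η, ⟨h1, h2, rfl, h4⟩, h5⟩ := hj
      refine ⟨_, ⟨h1, h2, rfl, h4⟩, (ih _).2 fun i => ?_⟩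
      by_cases hij : j = i
      · subst hij
        simpa using h5
      · have hij' : (j : ℕ) ≠ i := fun h => hij (Fin.ext h)
        have hi := h i
        rw [childSteps_cons, if_neg hij'] at hi
        simpa [hij'.symm] using hi

/-- A derivation that avoids the root keeps the root symbol. -/
theorem Derives.node_inv {G : WTGc S rk Q} {t : GTree rk} {a b : A}
    {ζs : Fin (rk b) → RTree rk Q} :
    ∀ {d : List (Production rk Q × List ℕ)} {ξs : Fin (rk a) → RTree rk Q},
      G.Derives t d (.node a ξs) (.node b ζs) → a = b
  | [], ξs, h => by
    simp only [Derives, RTree.node.injEq] at h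
    exact h.1
  | (p, w) :: d, ξs, h => by
    have h0 := h.ne_nil _ List.mem_cons_self
    obtain ⟨η, ⟨-, -, rfl, -⟩, h2⟩ := h
    rcases w with _ | ⟨i, w⟩
    · exact absurd rfl h0
    · exact Derives.node_inv h2

theorem exists_cons_of_derives {G : WTGc S rk Q} {a b : A} {ts : Fin (rk a) → GTree rk}
    {ζs : Fin (rk b) → RTree rk Q} {d : List (Production rk Q × List ℕ)} {ξ : RTree rk Q}
    (h : G.Derives (.node a ts) d ξ (.node b ζs)) :
    ∀ s ∈ d, ∃ (i : Fin (rk a)) (w : List ℕ), s.2 = (i : ℕ) :: w := by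
  intro s hs
  have h1 := h.ne_nil s hs
  obtain ⟨-, s', h2⟩ := h.mem s hs
  rcases hw : s.2 with _ | ⟨i, w⟩
  · exact absurd hw h1
  · rw [hw, RTree.subAt] at h2
    split_ifs at h2 with hi
    exact ⟨⟨i, hi⟩, w, rfl⟩

/-- The concatenation of sequences of steps in the children, in the order of the children. -/
def joinSteps {n : ℕ} (ds : Fin n → List (Production rk Q × List ℕ)) :
    List (Production rk Q × List ℕ) :=
  (List.ofFn fun i => (ds i).map fun s => (s.1, (i : ℕ) :: s.2)).flatten

theorem mem_joinSteps {n : ℕ} {ds : Fin n → List (Production rk Q × List ℕ)}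
    {s : Production rk Q × List ℕ} :
    s ∈ joinSteps ds ↔ ∃ (i : Fin n) (w : List ℕ), s.2 = (i : ℕ) :: w ∧ (s.1, w) ∈ ds i := by
  simp only [joinSteps, List.mem_flatten, List.mem_ofFn]
  constructor
  · rintro ⟨_, ⟨i, rfl⟩, h⟩
    obtain ⟨s', hs', rfl⟩ := List.mem_map.1 h
    exact ⟨i, s'.2, rfl, hs'⟩
  · rintro ⟨i, w, h1, h2⟩
    exact ⟨_, ⟨i, rfl⟩, List.mem_map.2 ⟨_, h2, by rw [← h1]⟩⟩

theorem pairwise_joinSteps {n : ℕ} {ds : Fin n → List (Production rk Q × List ℕ)}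
    (h : ∀ i, ((ds i).map Prod.snd).Pairwise Precedes) :
    ((joinSteps ds).map Prod.snd).Pairwise Precedes := by
  simp only [List.pairwise_map] at h ⊢
  rw [joinSteps, List.pairwise_flatten]
  constructor
  · intro l hl
    obtain ⟨i, rfl⟩ := List.mem_ofFn.1 hl
    rw [List.pairwise_map]
    exact (h i).imp fun hab => Or.inr ⟨rfl, hab⟩
  · rw [List.pairwise_ofFn]
    intro i j hij x hx y hy
    obtain ⟨x', -, rfl⟩ := List.mem_map.1 hx
    obtain ⟨y', -, rfl⟩ := List.mem_map.1 hy
    exact Or.inl hij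

theorem childSteps_joinSteps {n : ℕ} {ds : Fin n → List (Production rk Q × List ℕ)}
    (h : ∀ i, ((ds i).map Prod.snd).Pairwise Precedes) (i : Fin n) :
    childSteps i (joinSteps ds) = ds i := by
  refine eq_of_pairwise_precedes (pairwise_childSteps (pairwise_joinSteps h)) (h i) ?_
  rintro ⟨p, w⟩
  rw [mem_childSteps, mem_joinSteps]
  constructor
  · rintro ⟨j, v, h1, h2⟩
    simp only [List.cons.injEq] at h1
    obtain ⟨h1, rfl⟩ := h1
    rwa [Fin.ext h1]
  · intro h
    exact ⟨i, w, rfl, h⟩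

theorem derivWt_eq_prod_childSteps [CommSemiring S] (G : WTGc S rk Q) {n : ℕ} :
    ∀ {d : List (Production rk Q × List ℕ)},
      (∀ s ∈ d, ∃ (i : Fin n) (w : List ℕ), s.2 = (i : ℕ) :: w) →
      G.derivWt d = ∏ i : Fin n, G.derivWt (childSteps i d)
  | [], _ => by simp [derivWt]
  | (p, w) :: d, hd => by
    obtain ⟨j, w, rfl⟩ : ∃ (j : Fin n) (v : List ℕ), w = (j : ℕ) :: v :=
      hd _ List.mem_cons_self
    have ih := derivWt_eq_prod_childSteps G (n := n) (d := d)
      (fun s hs => hd s (List.mem_cons_of_mem _ hs))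
    have h1 : ∀ i : Fin n, G.derivWt (childSteps i ((p, (j : ℕ) :: w) :: d)) =
        (if j = i then G.wt p else 1) * G.derivWt (childSteps i d) := by
      intro i
      rw [childSteps_cons]
      by_cases hij : j = i
      · subst hij
        simp [derivWt]
      · have hij' : (j : ℕ) ≠ i := fun h => hij (Fin.ext h)
        simp [hij, hij']
    simp only [h1, Finset.prod_mul_distrib, ← ih]
    simp [derivWt]

theorem weight_node_of_ne [CommSemiring S] (G : WTGc S rk Q) {a b : A} (hab : a ≠ b)
    (ts : Fin (rk a) → GTree rk) (ξs : Fin (rk b) → RTree rk Q) :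
    G.weight (.node a ts) (.node b ξs) = 0 := by
  unfold weight
  rw [show G.formDerivations (.node a ts) (.node b ξs) = ∅ from ?_, finsum_mem_empty]
  exact Set.eq_empty_iff_forall_notMem.2 fun d hd => hab hd.1.node_inv

/-- Left-most derivations to a tree with root symbol `a` correspond to families of left-most
derivations in the children. -/
theorem weight_node [CommSemiring S] (G : WTGc S rk Q) {a : A}
    (ts : Fin (rk a) → GTree rk) (ξs : Fin (rk a) → RTree rk Q) :
    G.weight (.node a ts) (.node a ξs) = ∏ i, G.weight (ts i) (ξs i) := by
  classical
  unfold weight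
  simp only [finsum_mem_eq_finite_toFinset_sum _ (G.finite_formDerivations _ _)]
  rw [Finset.prod_univ_sum]
  have hsteps : ∀ ds : Fin (rk a) → List (Production rk Q × List ℕ), ∀ s ∈ joinSteps ds,
      ∃ (i : Fin (rk a)) (w : List ℕ), s.2 = (i : ℕ) :: w := fun ds s hs => by
    obtain ⟨i, w, h, -⟩ := mem_joinSteps.1 hs
    exact ⟨i, w, h⟩
  refine Finset.sum_bij' (fun d _ i => childSteps i d) (fun ds _ => joinSteps ds) ?_ ?_ ?_ ?_ ?_
  · intro d hd
    rw [Set.Finite.mem_toFinset] at hd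
    rw [Fintype.mem_piFinset]
    intro i
    rw [Set.Finite.mem_toFinset]
    exact ⟨(derives_node_iff (exists_cons_of_derives hd.1)).1 hd.1 i, pairwise_childSteps hd.2⟩
  · intro ds hds
    simp only [Fintype.mem_piFinset, Set.Finite.mem_toFinset] at hds ⊢
    refine ⟨(derives_node_iff (hsteps ds)).2 fun i => ?_, pairwise_joinSteps fun i => (hds i).2⟩
    rw [childSteps_joinSteps fun i => (hds i).2]
    exact (hds i).1
  · intro d hd
    rw [Set.Finite.mem_toFinset] at hd
    refine eq_of_pairwise_precedes (pairwise_joinSteps fun i => pairwise_childSteps hd.2) hd.2 ?_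
    rintro ⟨p, w⟩
    rw [mem_joinSteps]
    constructor
    · rintro ⟨i, v, h1, h2⟩
      simp only at h1 h2
      rw [h1]
      exact mem_childSteps.1 h2
    · intro h
      obtain ⟨i, v, h1⟩ := exists_cons_of_derives hd.1 _ h
      simp only at h1
      subst h1
      exact ⟨i, v, rfl, mem_childSteps.2 h⟩
  · intro ds hds
    simp only [Fintype.mem_piFinset, Set.Finite.mem_toFinset] at hds
    funext i
    exact childSteps_joinSteps (fun i => (hds i).2) i
  · intro d hd
    rw [Set.Finite.mem_toFinset] at hd
    exact G.derivWt_eq_prod_childSteps (exists_cons_of_derives hd.1)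

theorem language_eq [CommSemiring S] [Fintype Q] (G : WTGc S rk Q) (t : GTree rk) :
    G.language t = ∑ q, G.final q * G.weight t (.var q) := by
  refine Finset.sum_congr rfl fun q _ => ?_
  exact (mul_finsum_mem' _ _ (G.finite_formDerivations t (.var q))).symm

end WTGc

end TreeGrammar

namespace TreeGrammar

/-! ### Relabeling variables by position -/

namespace RTree

variable {A : Type u} {rk : A → ℕ} {Z : Type v} {Y : Type w}

/-- Every variable `z` at a position `w` is replaced by the variable `f w z`. -/
def relabel : (List ℕ → Z → Y) → RTree rk Z → RTree rk Y
  | f, var z => var (f [] z)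
  | f, node a ts => node a fun i => relabel (fun w => f ((i : ℕ) :: w)) (ts i)

@[simp] theorem subAt_nil (t : RTree rk Z) : t.subAt [] = some t := by
  simp [subAt]

theorem subAt_relabel (w : List ℕ) :
    ∀ (f : List ℕ → Z → Y) (r : RTree rk Z),
      (r.relabel f).subAt w = (r.subAt w).map (relabel fun v => f (w ++ v)) := by
  induction w with
  | nil => simp
  | cons i w ih =>
    rintro f (z | ⟨a, ts⟩)
    · simp [relabel, subAt]
    · by_cases hi : i < rk a
      · simp [relabel, subAt, hi, ih]
      · simp [relabel, subAt, hi]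

theorem subAt_relabel_eq_var {f : List ℕ → Z → Y} {r : RTree rk Z} {w : List ℕ} {y : Y} :
    (r.relabel f).subAt w = some (var y) ↔ ∃ z, r.subAt w = some (var z) ∧ f w z = y := by
  rw [subAt_relabel]
  rcases r.subAt w with _ | (z | ⟨a, ts⟩) <;> simp [relabel]

theorem subAt_subst {θ : Z → RTree rk Y} {z : Z} {w : List ℕ} :
    ∀ {r : RTree rk Z}, r.subAt w = some (var z) → (r.subst θ).subAt w = some (θ z) := by
  induction w with
  | nil =>
    intro r hr
    simp only [subAt_nil, Option.some.injEq] at hr ⊢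
    rw [hr, subst]
  | cons i w ih =>
    rintro (y | ⟨a, ts⟩) hr
    · simp [subAt] at hr
    · rw [subAt] at hr
      split_ifs at hr with hi
      simpa [subst, subAt, hi] using ih hr

theorem subst_injective {r : RTree rk Z} (hr : r.vars = Set.univ) {θ θ' : Z → RTree rk Y}
    (h : r.subst θ = r.subst θ') : θ = θ' := by
  funext z
  obtain ⟨w, hw⟩ : z ∈ r.vars := hr ▸ Set.mem_univ z
  have h1 := subAt_subst (θ := θ) hw
  rw [h, subAt_subst hw] at h1
  exact (Option.some.inj h1).symm

/-- The product of the values `g w z` over all positions `w` labeled by a variable `z`. -/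
def leafProd {S : Type*} [CommSemiring S] : (List ℕ → Z → S) → RTree rk Z → S
  | g, var z => g [] z
  | g, node a ts => ∏ i : Fin (rk a), leafProd (fun w => g ((i : ℕ) :: w)) (ts i)

theorem leafProd_one {S : Type*} [CommSemiring S] (r : RTree rk Z) :
    r.leafProd (fun _ _ => (1 : S)) = 1 := by
  induction r with
  | var z => rfl
  | node a ts ih => exact Finset.prod_eq_one fun i _ => ih i

theorem leafProd_prod {S ι : Type*} [CommSemiring S] (s : Finset ι) (r : RTree rk Z) :
    ∀ g : ι → List ℕ → Z → S,
      r.leafProd (fun w z => ∏ i ∈ s, g i w z) = ∏ i ∈ s, r.leafProd (g i) := by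
  induction r with
  | var z => exact fun g => rfl
  | node a ts ih =>
    intro g
    simp only [leafProd, ih]
    exact Finset.prod_comm

open Classical in
theorem leafProd_single {S : Type*} [CommSemiring S] (c : S) {o : List ℕ} {z : Z} :
    ∀ {r : RTree rk Z}, r.subAt o = some (var z) →
      r.leafProd (fun w y => if w = o ∧ y = z then c else 1) = c := by
  induction o with
  | nil =>
    intro r hr
    simp only [subAt_nil, Option.some.injEq] at hr
    simp [hr, leafProd]
  | cons j o ih =>
    rintro (y | ⟨a, ts⟩) hr
    · simp [subAt] at hr
    · rw [subAt] at hr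
      split_ifs at hr with hj
      rw [leafProd, Finset.prod_eq_single (⟨j, hj⟩ : Fin (rk a))]
      · simpa using ih hr
      · intro i _ hij
        have hij' : (i : ℕ) ≠ j := fun h => hij (Fin.ext h)
        simpa [hij'] using leafProd_one (S := S) (ts i)
      · simp

open Classical in
/-- If one occurrence of each variable `z` is weighted by `c z` and all other occurrences by `1`,
then the product is `∏ z, c z`. -/
theorem leafProd_occ {S : Type*} [CommSemiring S] [Fintype Z] (c : Z → S) {occ : Z → List ℕ}
    {r : RTree rk Z} (hocc : ∀ z, r.subAt (occ z) = some (var z)) :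
    r.leafProd (fun w z => if w = occ z then c z else 1) = ∏ z, c z := by
  have h1 : (fun w z => if w = occ z then c z else 1) =
      fun w y => ∏ z, if w = occ z ∧ y = z then c z else 1 := by
    funext w y
    rw [Finset.prod_eq_single y]
    · simp
    · intro z _ hz
      simp [hz.symm]
    · simp
  rw [h1, leafProd_prod]
  exact Finset.prod_congr rfl fun z _ => leafProd_single (c z) (hocc z)

/-- The pairs of positions at which the same variable occurs. -/
def sameVar (r : RTree rk Z) : Set Constraint :=
  {c | ∃ z, r.subAt c.1 = some (var z) ∧ r.subAt c.2 = some (var z)}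

theorem finite_sameVar (r : RTree rk Z) : r.sameVar.Finite := by
  refine (r.finite_pos.prod r.finite_pos).subset ?_
  rintro c ⟨z, h1, h2⟩
  exact ⟨⟨_, h1⟩, ⟨_, h2⟩⟩

end RTree

open RTree

open Classical in
/-- The weight of a relabeled tree `r` for an input tree in which all occurrences of a variable `z`
of `r` correspond to the same subtree `θ z`. -/
theorem WTGc.weight_relabel {S : Type w} {A : Type u} {rk : A → ℕ} {Q : Type v} {Z : Type x}
    [CommSemiring S] (G : WTGc S rk Q) (θ : Z → GTree rk) (r : RTree rk Z) :
    ∀ (f : List ℕ → Z → Q) (t : GTree rk),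
      (∀ w z, r.subAt w = some (var z) → t.subAt w = some (θ z)) →
      G.weight t (r.relabel f) =
        if t = r.subst θ then r.leafProd (fun w z => G.weight (θ z) (var (f w z))) else 0 := by
  induction r with
  | var z =>
    intro f t ht
    have h1 := ht [] z (by simp)
    simp only [subAt_nil, Option.some.injEq] at h1
    simp [h1, subst, relabel, leafProd]
  | node b rs ih =>
    intro f t ht
    rcases t with z | ⟨a, ts⟩
    · exact z.elim
    rw [relabel, subst, leafProd]
    by_cases hab : a = b
    · subst hab
      have h1 : ∀ i, _ := fun i => ih i (fun w => f ((i : ℕ) :: w)) (ts i) fun w z hw => by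
        have := ht (i :: w) z (by simpa [subAt] using hw)
        simpa [subAt] using this
      rw [weight_node]
      simp only [h1, node.injEq, heq_eq_eq, true_and]
      rw [Finset.prod_ite_zero]
      simp [funext_iff]
    · rw [G.weight_node_of_ne hab, if_neg]
      simp [hab]

/-! ### The image grammar -/

section Image

variable {S : Type w} [CommSemiring S] {A : Type x} {B : Type y} {rkA : A → ℕ} {rkB : B → ℕ}
  {Q : Type u}

/-- The label of a leaf, where `none` stands for the sink nonterminal. -/
def leafLabel : RTree rkA Q → Option Q
  | var q => some q
  | node _ _ => none

open Classical in
/-- The left-hand side `σ(q₁, …, q_k)` is sent to `h_σ`, in which the chosen occurrence of each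
variable `x_i` is replaced by `q_i`, and every other occurrence by the sink nonterminal `none`.
Left-hand sides that consist of a single nonterminal do not matter. -/
noncomputable def imageLhs (h : TreeHom rkA rkB) (occ : (a : A) → Fin (rkA a) → List ℕ) :
    RTree rkA Q → RTree rkB (Option Q)
  | var q => var (some q)
  | node a ts => (h a).relabel fun w i => if w = occ a i then leafLabel (ts i) else none

/-- The equality constraints between all occurrences of the same variable in `h_σ`. -/
noncomputable def imageEqs (h : TreeHom rkA rkB) : RTree rkA Q → Finset Constraint
  | var _ => ∅
  | node a _ => (h a).finite_sameVar.toFinset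

theorem imageLhs_ne {h : TreeHom rkA rkB} (hne : h.Nonerasing)
    (occ : (a : A) → Fin (rkA a) → List ℕ) (p : Production rkA Q) (q : Option Q) :
    imageLhs h occ p.lhs ≠ var q := by
  obtain ⟨a, ts, ha⟩ := WTGc.exists_node_lhs p
  rw [ha, imageLhs]
  cases hc : h a with
  | var i => exact absurd hc (hne a i)
  | node b us => simp [relabel]

/-- The image of a production under `h`. -/
noncomputable def imageProd {h : TreeHom rkA rkB} (hne : h.Nonerasing)
    (occ : (a : A) → Fin (rkA a) → List ℕ) (p : Production rkA Q) :
    Production rkB (Option Q) where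
  lhs := imageLhs h occ p.lhs
  target := some p.target
  eqs := imageEqs h p.lhs
  neqs := ∅
  lhs_ne := imageLhs_ne hne occ p

open Classical in
/-- The image grammar: the images of the productions of `G`, together with the productions of the
sink nonterminal `none`. Different productions of `G` may have the same image, in which case their
weights are added. -/
noncomputable def imageGrammar [Fintype B] {h : TreeHom rkA rkB} (hne : h.Nonerasing)
    (occ : (a : A) → Fin (rkA a) → List ℕ) (G : WTGc S rkA Q) : WTGc S rkB (Option Q) where
  final q := q.elim 0 G.final
  prods := G.prods.image (imageProd hne occ) ∪ Finset.univ.image (Production.loop none)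
  wt p' := if p'.target = none then 1 else ∑ p ∈ G.prods with imageProd hne occ p = p', G.wt p

variable {h : TreeHom rkA rkB} (hne : h.Nonerasing)
  {occ : (a : A) → Fin (rkA a) → List ℕ} (G : WTGc S rkA Q)

/-- Linked positions in the image of a production carry the same variable. -/
theorem linked_imageProd_iff {p : Production rkA Q} {a : A} {ts : Fin (rkA a) → RTree rkA Q}
    (hp : p.lhs = node a ts) {i j : (imageProd hne occ p).lhs.varPos} {z : Fin (rkA a)}
    (hi : (h a).subAt i = some (var z)) :
    (imageProd hne occ p).Linked i j ↔ (h a).subAt j = some (var z) := by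
  have hE : ∀ i j : (imageProd hne occ p).lhs.varPos,
      ((i : List ℕ), (j : List ℕ)) ∈ (imageProd hne occ p).eqs ↔
        ∃ z, (h a).subAt i = some (var z) ∧ (h a).subAt j = some (var z) := by
    intro i j
    simp only [imageProd, hp, imageEqs, Set.Finite.mem_toFinset]
    rfl
  constructor
  · intro hij
    have key : ∀ z, (h a).subAt i = some (var z) ↔ (h a).subAt j = some (var z) := by
      clear hi
      induction hij with
      | rel i j hij =>
        obtain ⟨z, h1, h2⟩ := (hE i j).1 hij
        intro z'
        rw [h1, h2]
      | refl i => exact fun z => Iff.rfl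
      | symm i j _ ih => exact fun z => (ih z).symm
      | trans i j k _ _ ih1 ih2 => exact fun z => (ih1 z).trans (ih2 z)
    exact (key z).1 hi
  · intro hj
    exact Relation.EqvGen.rel _ _ ((hE i j).2 ⟨z, hi, hj⟩)

/-- A tree satisfies the constraints of the image of a production if and only if all occurrences of
the same variable of `h_σ` are positions with the same subtree. -/
theorem admits_imageProd_iff (hocc : ∀ a i, (h a).subAt (occ a i) = some (var i))
    {p : Production rkA Q} {a : A} {ts : Fin (rkA a) → RTree rkA Q} (hp : p.lhs = node a ts)
    (u : GTree rkB) :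
    (imageProd hne occ p).Admits u ↔ ∃ θ : Fin (rkA a) → GTree rkB,
      ∀ w i, (h a).subAt w = some (var i) → u.subAt w = some (θ i) := by
  have hA : (imageProd hne occ p).Admits u ↔ ∀ c ∈ (h a).sameVar, Satisfies u c := by
    simp [Production.Admits, imageProd, hp, imageEqs]
  rw [hA]
  constructor
  · intro h1
    -- The constraint of an occurrence with itself only says that it is a position of `u`.
    choose θ hθ _ using fun i => h1 (occ a i, occ a i) ⟨i, hocc a i, hocc a i⟩
    refine ⟨θ, fun w i hw => ?_⟩
    obtain ⟨s, h2, h3⟩ := h1 (occ a i, w) ⟨i, hocc a i, hw⟩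
    have h4 := hθ i
    simp only at h2 h3 h4
    rw [h3, ← h2, h4]
  · rintro ⟨θ, hθ⟩ c ⟨i, h1, h2⟩
    exact ⟨θ i, hθ _ _ h1, hθ _ _ h2⟩

/-- The preimages of `h_σ[θ]` with root symbol `σ` are the trees `σ(t₁, …, t_k)` where each `t_i` is
a preimage of `θ i`. -/
theorem finsum_weight_preimage_subst [Finite A] (hnd : h.Nondeleting) (he : h.Nonerasing) (a : A)
    (θ : Fin (rkA a) → GTree rkB) (qs : Fin (rkA a) → RTree rkA Q) :
    ∑ᶠ t ∈ {t | h.apply t = (h a).subst θ}, G.weight t (node a qs) =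
      ∏ i, ∑ᶠ t ∈ {t | h.apply t = θ i}, G.weight t (qs i) := by
  classical
  simp only [finsum_mem_eq_finite_toFinset_sum _ (h.finite_preimage hnd he _)]
  rw [Finset.prod_univ_sum]
  symm
  refine Finset.sum_of_injOn (fun ts => node a ts) ?_ ?_ ?_ ?_
  · intro ts _ ts' _ hts
    simpa using hts
  · intro ts hts
    simp only [SetLike.mem_coe, Fintype.mem_piFinset, Set.Finite.mem_toFinset,
      Set.mem_ofPred_eq, TreeHom.apply] at hts ⊢
    simp [hts]
  · rintro (z | ⟨b, ts⟩) ht ht'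
    · exact z.elim
    by_cases hab : b = a
    · subst hab
      refine absurd ⟨ts, ?_, rfl⟩ ht'
      simp only [SetLike.mem_coe, Fintype.mem_piFinset, Set.Finite.mem_toFinset,
        Set.mem_ofPred_eq, TreeHom.apply] at ht ⊢
      exact congrFun (subst_injective (hnd b) ht)
    · exact G.weight_node_of_ne hab _ _
  · intro ts _
    exact (G.weight_node ts qs).symm

variable [Fintype B]

theorem mem_imageGrammar_prods {p' : Production rkB (Option Q)} :
    p' ∈ (imageGrammar hne occ G).prods ↔
      (∃ p ∈ G.prods, imageProd hne occ p = p') ∨ ∃ b, Production.loop none b = p' := by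
  simp [imageGrammar]

theorem imageGrammar_positive : (imageGrammar hne occ G).Positive := by
  intro p' hp'
  rcases (mem_imageGrammar_prods hne G).1 hp' with ⟨p, -, rfl⟩ | ⟨b, rfl⟩ <;> rfl

theorem imageGrammar_classic : (imageGrammar hne occ G).Classic := by
  intro p' hp' c hc
  rcases (mem_imageGrammar_prods hne G).1 hp' with ⟨p, -, rfl⟩ | ⟨b, rfl⟩
  · rcases hc with hc | hc
    · obtain ⟨a, ts, ha⟩ := WTGc.exists_node_lhs p
      simp only [imageProd, ha, imageEqs, imageLhs, Set.Finite.mem_toFinset] at hc ⊢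
      obtain ⟨i, h1, h2⟩ := hc
      exact ⟨⟨_, subAt_relabel_eq_var.2 ⟨i, h1, rfl⟩⟩, ⟨_, subAt_relabel_eq_var.2 ⟨i, h2, rfl⟩⟩⟩
    · simp [imageProd] at hc
  · simp [Production.loop] at hc

theorem imageGrammar_isSink : (imageGrammar hne occ G).IsSink none := by
  refine ⟨rfl, ?_, fun b => by simp [imageGrammar, Production.loop]⟩
  ext p'
  simp only [Set.mem_ofPred_eq, mem_imageGrammar_prods, Set.mem_range]
  constructor
  · rintro ⟨⟨p, -, rfl⟩ | h1, h2⟩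
    · simp [imageProd] at h2
    · exact h1
  · rintro ⟨b, rfl⟩
    exact ⟨Or.inr ⟨b, rfl⟩, rfl⟩

theorem imageGrammar_eqRestricted (hG : G.IsWTA)
    (hocc : ∀ a i, (h a).subAt (occ a i) = some (var i)) :
    (imageGrammar hne occ G).EqRestricted := by
  refine ⟨none, imageGrammar_isSink hne G, ?_⟩
  intro p' hp'
  rcases (mem_imageGrammar_prods hne G).1 hp' with ⟨p, hp, rfl⟩ | ⟨b, rfl⟩
  · obtain ⟨a, qs, ha⟩ := (hG p hp).1
    have hlhs : (imageProd hne occ p).lhs = imageLhs h occ (node a fun i => var (qs i)) := by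
      rw [← ha]
      rfl
    have hvar : ∀ w q, (imageProd hne occ p).lhs.subAt w = some (var q) ↔
        ∃ i, (h a).subAt w = some (var i) ∧ (if w = occ a i then some (qs i) else none) = q := by
      intro w q
      rw [hlhs, imageLhs, subAt_relabel_eq_var]
      rfl
    intro i
    obtain ⟨q, hq⟩ := i.2
    obtain ⟨z, hz, -⟩ := (hvar _ _).1 hq
    refine ⟨some (qs z), ?_, ?_⟩
    · intro j hj
      rw [linked_imageProd_iff hne ha hz] at hj
      rw [hvar, hvar]
      by_cases h1 : (j : List ℕ) = occ a z
      · exact Or.inl ⟨z, hj, by simp [h1]⟩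
      · exact Or.inr ⟨z, hj, by simp [h1]⟩
    · have h1 := (hvar (occ a z) (some (qs z))).2 ⟨z, hocc a z, by simp⟩
      refine ⟨⟨occ a z, _, h1⟩, ⟨(linked_imageProd_iff hne ha hz).2 (hocc a z), h1⟩, ?_⟩
      rintro j ⟨h2, h3⟩
      rw [linked_imageProd_iff hne ha hz] at h2
      obtain ⟨z', h4, h5⟩ := (hvar _ _).1 h3
      rw [h2] at h4
      simp only [Option.some.injEq, var.injEq] at h4
      subst h4
      refine Subtype.ext ?_
      by_contra h6
      rw [if_neg h6] at h5
      cases h5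
  · intro i
    have hlink : ∀ j, (Production.loop (rk := rkB) (none : Option Q) b).Linked i j ↔ i = j := by
      intro j
      constructor
      · intro hij
        induction hij with
        | rel i j hij => simp [Production.loop] at hij
        | refl i => rfl
        | symm i j _ ih => exact ih.symm
        | trans i j k _ _ ih1 ih2 => exact ih1.trans ih2
      · rintro rfl
        exact Relation.EqvGen.refl _
    have hi : (Production.loop (rk := rkB) (none : Option Q) b).lhs.subAt i =
        some (var none) := by
      obtain ⟨_ | ⟨j, w⟩, q, hq⟩ := i
      · simp [Production.loop] at hq
      · simp only [Production.loop, subAt] at hq ⊢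
        split_ifs at hq ⊢
        rcases w with _ | ⟨k, w⟩
        · simp
        · simp [subAt] at hq
    refine ⟨none, ?_, i, ⟨(hlink i).2 rfl, hi⟩, fun j hj => ((hlink j).1 hj.1).symm⟩
    rintro j hj
    rw [← (hlink j).1 hj]
    exact Or.inl hi

/-! ### The language of the image grammar -/

/-- Every tree has exactly one derivation to the sink nonterminal, of weight `1`. -/
theorem weight_imageGrammar_none (u : GTree rkB) :
    (imageGrammar hne occ G).weight u (var none) = 1 := by
  induction u with
  | var z => exact z.elim
  | node b us ih =>
    obtain ⟨-, hs, hw⟩ := imageGrammar_isSink (occ := occ) hne G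
    have hset : {p | p ∈ (imageGrammar hne occ G).prods ∧ p.target = none ∧
        p.Admits (node b us)} = Set.range (Production.loop none) := by
      rw [← hs]
      ext p
      simp only [Set.mem_ofPred_eq]
      refine ⟨fun hp => ⟨hp.1, hp.2.1⟩, fun hp => ⟨hp.1, hp.2, ?_⟩⟩
      have hp' := hs.subset hp
      obtain ⟨c, rfl⟩ := hp'
      simp [Production.Admits, Production.loop]
    rw [WTGc.weight_var, hset, finsum_mem_range, finsum_eq_single _ b]
    · rw [hw, one_mul, Production.loop, WTGc.weight_node]
      exact Finset.prod_eq_one fun i _ => ih i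
    · intro c hc
      rw [Production.loop, WTGc.weight_node_of_ne _ hc.symm, mul_zero]
    · intro c c' hcc'
      simp only [Production.loop, Production.mk.injEq, node.injEq] at hcc'
      exact hcc'.1.1

open Classical in
/-- One production: its image is used at the root of `u` with the total weight with which the
production itself is used at the roots of the preimages of `u`, provided that this holds for all
smaller trees. -/
theorem weight_imageProd [Finite A] (hnd : h.Nondeleting)
    (hocc : ∀ a i, (h a).subAt (occ a i) = some (var i)) {p : Production rkA Q} {a : A}
    {qs : Fin (rkA a) → Q} (hp : p.lhs = node a fun i => var (qs i)) (u : GTree rkB)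
    (ih : ∀ u' : GTree rkB, u'.depth < u.depth → ∀ q,
      (imageGrammar hne occ G).weight u' (var (some q)) =
        ∑ᶠ t ∈ {t | h.apply t = u'}, G.weight t (var q)) :
    (if (imageProd hne occ p).Admits u then
      (imageGrammar hne occ G).weight u (imageProd hne occ p).lhs else 0) =
        ∑ᶠ t ∈ {t | h.apply t = u}, G.weight t p.lhs := by
  have hlhs : (imageProd hne occ p).lhs =
      (h a).relabel fun w i => if w = occ a i then some (qs i) else none := by
    simp only [imageProd, hp, imageLhs]
    rfl
  have hw : ∀ θ : Fin (rkA a) → GTree rkB,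
      (∀ w i, (h a).subAt w = some (var i) → u.subAt w = some (θ i)) →
      (imageGrammar hne occ G).weight u (imageProd hne occ p).lhs =
        if u = (h a).subst θ then
          ∏ i, (imageGrammar hne occ G).weight (θ i) (var (some (qs i))) else 0 := by
    intro θ hθ
    rw [hlhs, WTGc.weight_relabel _ θ _ _ _ hθ, ← leafProd_occ _ (hocc a)]
    congr 2
    -- The unchosen occurrences carry the sink nonterminal and contribute the factor `1`.
    funext w i
    split_ifs
    · rfl
    · exact weight_imageGrammar_none hne G (θ i)
  rw [admits_imageProd_iff hne hocc hp, hp]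
  by_cases hu : ∃ θ, u = (h a).subst θ
  · obtain ⟨θ, hθ⟩ := hu
    have hsub : ∀ w i, (h a).subAt w = some (var i) → u.subAt w = some (θ i) := by
      rw [hθ]
      exact fun w i hw => subAt_subst hw
    rw [if_pos ⟨θ, hsub⟩, hw θ hsub, if_pos hθ, hθ, finsum_weight_preimage_subst G hnd hne]
    refine Finset.prod_congr rfl fun i _ => ih _ ?_ _
    have h1 := depth_le_subst θ i _ _ (hocc a i)
    have h2 : occ a i ≠ [] := fun h2 => by
      have h3 := hocc a i
      rw [h2] at h3
      simp only [subAt_nil, Option.some.injEq] at h3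
      exact hne a i h3
    have h3 := List.length_pos_iff.2 h2
    rw [hθ]
    omega
  · rw [finsum_mem_eq_zero_of_forall_eq_zero]
    · split_ifs with h1
      · obtain ⟨θ, hθ⟩ := h1
        rw [hw θ hθ, if_neg fun h2 => hu ⟨θ, h2⟩]
      · rfl
    · rintro (z | ⟨b, ts⟩) ht
      · exact z.elim
      refine G.weight_node_of_ne ?_ _ _
      rintro rfl
      exact hu ⟨_, ht.symm⟩

open Classical in
/-- The last step of a derivation of the image grammar uses the image of a production of `G`; the
weight of this image is the sum of the weights of all productions that it comes from. -/
theorem weight_imageGrammar_some_eq_sum (u : GTree rkB) (q : Q) :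
    (imageGrammar hne occ G).weight u (var (some q)) =
      ∑ p ∈ G.prods with p.target = q, G.wt p *
        (if (imageProd hne occ p).Admits u then
          (imageGrammar hne occ G).weight u (imageProd hne occ p).lhs else 0) := by
  have hset : {p' | p' ∈ (imageGrammar hne occ G).prods ∧ p'.target = some q ∧ p'.Admits u} =
      (((G.prods.filter fun p => p.target = q ∧ (imageProd hne occ p).Admits u).image
        (imageProd hne occ) : Finset _) : Set (Production rkB (Option Q))) := by
    ext p'
    simp only [Set.mem_ofPred_eq, mem_imageGrammar_prods, Finset.coe_image, Finset.coe_filter,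
      Set.mem_image]
    constructor
    · rintro ⟨⟨p, hp, rfl⟩ | ⟨b, rfl⟩, h2, h3⟩
      · exact ⟨p, ⟨hp, Option.some.inj h2, h3⟩, rfl⟩
      · simp [Production.loop] at h2
    · rintro ⟨p, ⟨hp, rfl, h3⟩, rfl⟩
      exact ⟨Or.inl ⟨p, hp, rfl⟩, rfl, h3⟩
  rw [WTGc.weight_var, hset, finsum_mem_coe_finset]
  simp only [mul_ite, mul_zero]
  rw [← Finset.sum_filter, Finset.filter_filter]
  refine Finset.sum_image' _ fun p hp => ?_
  simp only [Finset.mem_filter] at hp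
  have hwt : (imageGrammar hne occ G).wt (imageProd hne occ p) =
      ∑ p₁ ∈ G.prods with imageProd hne occ p₁ = imageProd hne occ p, G.wt p₁ := by
    simp [imageGrammar, imageProd]
  rw [hwt, Finset.sum_mul, Finset.filter_filter]
  have hfilter : (G.prods.filter fun p₁ => imageProd hne occ p₁ = imageProd hne occ p) =
      G.prods.filter fun p₁ => (p₁.target = q ∧ (imageProd hne occ p₁).Admits u) ∧
        imageProd hne occ p₁ = imageProd hne occ p := by
    refine Finset.filter_congr fun p₁ _ => ⟨fun h1 => ⟨⟨?_, ?_⟩, h1⟩, fun h1 => h1.2⟩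
    · have := congrArg Production.target h1
      simp only [imageProd, Option.some.injEq] at this
      rw [this, hp.2.1]
    · rw [h1]
      exact hp.2.2
  rw [hfilter]
  refine Finset.sum_congr rfl fun p₁ hp₁ => ?_
  rw [(Finset.mem_filter.1 hp₁).2.2]

/-- The productions of an automaton admit every tree. -/
theorem WTGc.IsWTA.weight_var {G : WTGc S rkA Q} (hG : G.IsWTA) (t : GTree rkA) (q : Q)
    [DecidableEq Q] :
    G.weight t (var q) = ∑ p ∈ G.prods with p.target = q, G.wt p * G.weight t p.lhs := by
  rw [WTGc.weight_var, ← finsum_mem_coe_finset]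
  refine finsum_mem_congr (Set.ext fun p => ?_) fun _ _ => rfl
  simp only [Set.mem_ofPred_eq, Finset.coe_filter]
  refine ⟨fun hp => ⟨hp.1, hp.2.1⟩, fun hp => ⟨hp.1, hp.2, ?_⟩⟩
  obtain ⟨h1, h2⟩ := (hG p hp.1).2
  simp [Production.Admits, h1, h2]

/-- The derivations of the image grammar for `u` to `q` have the same total weight as the derivations
of `G` to `q` for all preimages of `u`. The bound `n` on the depth serves the induction. -/
theorem weight_imageGrammar_some [Finite A] (hG : G.IsWTA) (hnd : h.Nondeleting)
    (hocc : ∀ a i, (h a).subAt (occ a i) = some (var i)) (n : ℕ) :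
    ∀ u : GTree rkB, u.depth < n → ∀ q, (imageGrammar hne occ G).weight u (var (some q)) =
      ∑ᶠ t ∈ {t | h.apply t = u}, G.weight t (var q) := by
  classical
  induction n with
  | zero => exact fun u hu => absurd hu (Nat.not_lt_zero _)
  | succ n ih =>
    intro u hu q
    have hfin := h.finite_preimage hnd hne u
    rw [weight_imageGrammar_some_eq_sum]
    simp only [hG.weight_var]
    rw [finsum_mem_eq_finite_toFinset_sum _ hfin, Finset.sum_comm]
    refine Finset.sum_congr rfl fun p hp => ?_
    obtain ⟨a, qs, ha⟩ := (hG p (Finset.mem_filter.1 hp).1).1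
    rw [weight_imageProd hne G hnd hocc ha u fun u' hu' => ih u' (by omega),
      finsum_mem_eq_finite_toFinset_sum _ hfin, Finset.mul_sum]

/-- Summing over the nonterminals: the sink nonterminal has final weight `0`. -/
theorem language_imageGrammar [Finite A] [Fintype Q] (hG : G.IsWTA) (hnd : h.Nondeleting)
    (hocc : ∀ a i, (h a).subAt (occ a i) = some (var i)) :
    (imageGrammar hne occ G).language = h.image G.language := by
  funext u
  have hfin := h.finite_preimage hnd hne u
  simp only [TreeHom.image, WTGc.language_eq, Fintype.sum_option]
  rw [finsum_mem_eq_finite_toFinset_sum _ hfin, Finset.sum_comm]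
  rw [show (imageGrammar hne occ G).final none = 0 from rfl, zero_mul, zero_add]
  refine Finset.sum_congr rfl fun q _ => ?_
  rw [weight_imageGrammar_some hne G hG hnd hocc (u.depth + 1) u (Nat.lt_succ_self _),
    finsum_mem_eq_finite_toFinset_sum _ hfin, Finset.mul_sum]
  rfl

end Image

end TreeGrammar

theorem mainTheorem1 {S : Type w} [CommSemiring S] {A : Type x} {B : Type y} [Finite A] [Finite B]
    (rkA : A → ℕ) (rkB : B → ℕ) {Q : Type u} [Fintype Q]
    (G : TreeGrammar.WTGc S rkA Q) (hG : G.IsWTA)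
    (h : TreeGrammar.TreeHom rkA rkB) (hnd : h.Nondeleting) (hne : h.Nonerasing) :
    ∃ (Q' : Type u) (_ : Fintype Q') (G' : TreeGrammar.WTGc S rkB Q'),
      G'.EqRestricted ∧ G'.Positive ∧ G'.Classic ∧ G'.language = h.image G.language := by
  have := Fintype.ofFinite B
  have hocc : ∀ a (i : Fin (rkA a)), ∃ w, (h a).subAt w = some (TreeGrammar.RTree.var i) :=
    fun a i => (hnd a).symm.subset (Set.mem_univ i)
  choose occ hocc using hocc
  exact ⟨Option Q, inferInstance, TreeGrammar.imageGrammar hne occ G,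
    TreeGrammar.imageGrammar_eqRestricted hne G hG hocc,
    TreeGrammar.imageGrammar_positive hne G, TreeGrammar.imageGrammar_classic hne G,
    TreeGrammar.language_imageGrammar hne G hG hnd hocc⟩
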